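/- Let $n\ge 1$, let $\langle\cdot,\cdot\rangle$ be the Euclidean inner product on $\mathbb{R}^n$, and let $du$ denote surface measure ($(n-1)$-dimensional Hausdorff measure) on the unit sphere $S^{n-1}$. Let $\Omega\subset S^{n-1}$ be a closed set not contained in any closed hemisphere, and let $C^+(\Omega)$ be the set of strictly positive continuous functions on $\Omega$. For $f\in C^+(\Omega)$ let $[f]=\bigcap_{u\in\Omega}\{x\in\mathbb{R}^n:\langle x,u\rangle\le f(u)\}$ be its Aleksandrov body; it is a compact convex set containing the origin in its interior. For such a convex body $K$ let $h_K(u)=\sup_{x\in K}\langle u,x\rangle$ and $\rho_K(u)=\sup\{\lambda>0:\lambda u\in K\}$, $u\in S^{n-1}$, be its support and radial functions, and for $E\subset S^{n-1}$ let $$\boldsymbol{\alpha}^*_K(E)=\{x/|x|:\ x\in\partial K,\ \langle x,u\rangle=h_K(u)\text{ for some }u\in E\}.$$ Let $G:(0,\infty)\times S^{n-1}\to\mathbb{R}$ be continuous with a partial derivative $G_t=\partial G/\partial t$ that exists and is continuous on $(0,\infty)\times S^{n-1}$. Put $$\widetilde V_G(K)=\int_{S^{n-1}}G(\rho_K(u),u)\,du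 .$$ The formula $$\widetilde C_G(K,E)=\frac1n\int_{\boldsymbol{\alpha}^*_K(E)}\rho_K(u)\,G_t(\rho_K(u),u)\,du,\qquad E\subset S^{n-1}\text{ Borel},$$ defines a finite signed Borel measure $\widetilde C_G(K,\cdot)$ on $S^{n-1}$ (for $K=[f]$, $f\in C^+(\Omega)$; the sets $\boldsymbol{\alpha}^*_K(E)$ are measurable with respect to the completion of surface measure). Let $\mathcal I$ (respectively $\mathcal D$) be the class of continuous, strictly increasing (respectively strictly decreasing) functions $\varphi:(0,\infty)\to(0,\infty)$ with $\varphi(1)=1$, $\lim_{t\to0^+}\varphi(t)=0$ and $\lim_{t\to\infty}\varphi(t)=\infty$ (respectively $\varphi(1)=1$, $\lim_{t\to0^+}\varphi(t)=\infty$ and $\lim_{t\to\infty}\varphi(t)=0$). **Theorem.** Let $h_1,h_2\in C^+(\Omega)$, and let either $\varphi_1,\varphi_2\in\mathcal I$ or $\varphi_1,\varphi_2\in\mathcal D$. Suppose that $\varphi_1$ and $\varphi_2$ are continuously differentiable with $\varphi_1'$ and $\varphi_2'$ nonzero on $(0,\infty)$. For $\varepsilon>0$ let $h_\varepsilon:\Omega\to(0,\infty)$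 be the function defined (implicitly and uniquely) by $$\varphi_1\!\left(\frac{h_1(u)}{h_\varepsilon(u)}\right)+\varepsilon\,\varphi_2\!\left(\frac{h_2(u)}{h_\varepsilon(u)}\right)=1,\qquad u\in\Omega .$$ Then $$\lim_{\varepsilon\to0^+}\frac{\widetilde V_G([h_\varepsilon])-\widetilde V_G([h_1])}{\varepsilon}=\frac{n}{\varphi_1'(1)}\int_\Omega\varphi_2\!\left(\frac{h_2(u)}{h_1(u)}\right)d\widetilde C_G([h_1],u).$$ -/

import Mathlib

open Set Filter Topology MeasureTheory
open scoped RealInnerProductSpace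

noncomputable section

namespace DualOrlicz

/-- The unit sphere `S^{n-1}` of `ℝⁿ`. -/
abbrev Sph (n : ℕ) : Type := Metric.sphere (0 : EuclideanSpace ℝ (Fin n)) 1

/-- The surface measure `du` on `S^{n-1}`, that is, the `(n-1)`-dimensional Hausdorff measure
normalized as usual, so that a Borel set `A` has measure `n` times the Lebesgue measure of the
cone `{r u : 0 < r < 1, u ∈ A}`. -/
abbrev sphMeasure (n : ℕ) : Measure (Sph n) :=
  (volume : Measure (EuclideanSpace ℝ (Fin n))).toSphere

/-- The class `𝓘`: continuous strictly increasing functions `(0, ∞) → (0, ∞)` with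
`φ(1) = 1`, `φ(0+) = 0`, `φ(∞) = ∞`. Only the values on `(0, ∞)` matter. -/
structure IsClassI (φ : ℝ → ℝ) : Prop where
  pos : ∀ t, 0 < t → 0 < φ t
  cont : ContinuousOn φ (Ioi 0)
  mono : StrictMonoOn φ (Ioi 0)
  one : φ 1 = 1
  zero : Tendsto φ (𝓝[>] 0) (𝓝 0)
  top : Tendsto φ atTop atTop

/-- The class `𝓓`: continuous strictly decreasing functions `(0, ∞) → (0, ∞)` with
`φ(1) = 1`, `φ(0+) = ∞`, `φ(∞) = 0`. Only the values on `(0, ∞)` matter. -/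
structure IsClassD (φ : ℝ → ℝ) : Prop where
  pos : ∀ t, 0 < t → 0 < φ t
  cont : ContinuousOn φ (Ioi 0)
  anti : StrictAntiOn φ (Ioi 0)
  one : φ 1 = 1
  zero : Tendsto φ (𝓝[>] 0) atTop
  top : Tendsto φ atTop (𝓝 0)

variable {n : ℕ}

/-- `Ω ⊆ S^{n-1}` is closed and not contained in any closed hemisphere
`{u : ⟨u, v⟩ ≥ 0}`, `v ∈ S^{n-1}`. -/
def IsAdmissibleDomain (Ω : Set (Sph n)) : Prop :=
  IsClosed Ω ∧ ∀ v : Sph n, ¬ Ω ⊆ {u : Sph n | 0 ≤ ⟪(u : EuclideanSpace ℝ (Fin n)), v⟫}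

/-- `f ∈ C⁺(Ω)`: continuous and strictly positive on `Ω`. -/
def IsCPos (Ω : Set (Sph n)) (f : Sph n → ℝ) : Prop :=
  ContinuousOn f Ω ∧ ∀ u ∈ Ω, 0 < f u

/-- The Aleksandrov body (Wulff shape) `[f] = ⋂_{u ∈ Ω} {x : ⟨x, u⟩ ≤ f u}`. -/
def aleksandrovBody (Ω : Set (Sph n)) (f : Sph n → ℝ) : Set (EuclideanSpace ℝ (Fin n)) :=
  ⋂ u ∈ Ω, {x | ⟪x, (u : EuclideanSpace ℝ (Fin n))⟫ ≤ f u}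

/-- `f` is the function `h_ε` on `Ω` defined implicitly by
`φ₁(h₁ / h_ε) + ε φ₂(h₂ / h_ε) = 1`. -/
def IsOrliczCombination (Ω : Set (Sph n)) (φ₁ φ₂ : ℝ → ℝ) (h₁ h₂ : Sph n → ℝ) (ε : ℝ)
    (f : Sph n → ℝ) : Prop :=
  ∀ u ∈ Ω, 0 < f u ∧ φ₁ (h₁ u / f u) + ε * φ₂ (h₂ u / f u) = 1

/-- The support function `h_K(u) = sup_{x ∈ K} ⟨u, x⟩`. -/
def supportFn (K : Set (EuclideanSpace ℝ (Fin n))) (u : Sph n) : ℝ :=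
  sSup ((fun x => ⟪(u : EuclideanSpace ℝ (Fin n)), x⟫) '' K)

/-- The radial function `ρ_K(u) = sup {r > 0 : r u ∈ K}`. -/
def radialFn (K : Set (EuclideanSpace ℝ (Fin n))) (u : Sph n) : ℝ :=
  sSup {r : ℝ | 0 < r ∧ r • (u : EuclideanSpace ℝ (Fin n)) ∈ K}

/-- The general dual volume `Ṽ_G(K) = ∫ G(ρ_K(u), u) du`. -/
def dualVolume (G : ℝ → Sph n → ℝ) (K : Set (EuclideanSpace ℝ (Fin n))) : ℝ :=
  ∫ u, G (radialFn K u) u ∂(sphMeasure n)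

/-- The partial derivative `G_t(t, u) = ∂G(t, u)/∂t`. -/
def partialT (G : ℝ → Sph n → ℝ) (t : ℝ) (u : Sph n) : ℝ :=
  deriv (fun s => G s u) t

/-- The supporting hyperplane `H(K, u) = {x : ⟨x, u⟩ = h_K(u)}`. -/
def supportingHyperplane (K : Set (EuclideanSpace ℝ (Fin n))) (u : Sph n) :
    Set (EuclideanSpace ℝ (Fin n)) :=
  {x | ⟪x, (u : EuclideanSpace ℝ (Fin n))⟫ = supportFn K u}

/-- The reverse radial Gauss image
`α*_K(E) = {x / |x| : x ∈ ∂K ∩ H(K, u) for some u ∈ E}`. -/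
def reverseRadialGaussImage (K : Set (EuclideanSpace ℝ (Fin n))) (E : Set (Sph n)) :
    Set (Sph n) :=
  {v | ∃ u ∈ E, ∃ x ∈ frontier K ∩ supportingHyperplane K u,
    (v : EuclideanSpace ℝ (Fin n)) = ‖x‖⁻¹ • x}

/-- The set function
`E ↦ (1/n) ∫_{α*_K(E)} ρ_K(u) G_t(ρ_K(u), u) du` (the case `ψ ≡ 1`). -/
def dualCurvatureSetFn (G : ℝ → Sph n → ℝ) (K : Set (EuclideanSpace ℝ (Fin n)))
    (E : Set (Sph n)) : ℝ :=
  (1 / (n : ℝ)) * ∫ u in reverseRadialGaussImage K E,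
    radialFn K u * partialT G (radialFn K u) u ∂(sphMeasure n)

open Classical in
/-- The general dual Orlicz curvature measure `C̃_G(K, ·)`: the finite signed Borel measure on
`S^{n-1}` whose value on each Borel set `E` is `dualCurvatureSetFn G K E`. Such a signed measure
is unique; the value `0` is used where there is none. -/
def dualCurvatureMeasure (G : ℝ → Sph n → ℝ) (K : Set (EuclideanSpace ℝ (Fin n))) :
    SignedMeasure (Sph n) :=
  if h : ∃ μ : SignedMeasure (Sph n), ∀ E, MeasurableSet E → μ E = dualCurvatureSetFn G K E
  then h.choose else 0

/-- The defining equation of `h_ε` has exactly one positive solution at every point. -/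
theorem existsUnique_orlicz {φ₁ φ₂ : ℝ → ℝ}
    (hφ : (IsClassI φ₁ ∧ IsClassI φ₂) ∨ (IsClassD φ₁ ∧ IsClassD φ₂))
    {a b ε : ℝ} (ha : 0 < a) (hb : 0 < b) (hε : 0 < ε) :
    ∃! x : ℝ, 0 < x ∧ φ₁ (a / x) + ε * φ₂ (b / x) = 1 := by
  -- work with `s = 1 / x`
  suffices h : ∃! s : ℝ, 0 < s ∧ φ₁ (a * s) + ε * φ₂ (b * s) = 1 by
    obtain ⟨s, ⟨hs, hs1⟩, huniq⟩ := h
    refine ⟨s⁻¹, ⟨inv_pos.2 hs, by simpa [div_eq_mul_inv] using hs1⟩, ?_⟩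
    rintro y ⟨hy, hy1⟩
    have := huniq y⁻¹ ⟨inv_pos.2 hy, by simpa [div_eq_mul_inv] using hy1⟩
    rw [← this, inv_inv]
  have hmem : ∀ c : ℝ, 0 < c → ∀ s ∈ Ioi (0 : ℝ), c * s ∈ Ioi (0 : ℝ) :=
    fun c hc s hs => mul_pos hc hs
  have hzero : ∀ c : ℝ, 0 < c → Tendsto (fun s : ℝ => c * s) (𝓝[>] 0) (𝓝[>] 0) := by
    intro c hc
    refine tendsto_nhdsWithin_iff.2 ⟨?_, ?_⟩
    · have : Tendsto (fun s : ℝ => c * s) (𝓝 0) (𝓝 (c * 0)) :=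
        (continuous_const.mul continuous_id).tendsto 0
      rw [mul_zero] at this
      exact this.mono_left nhdsWithin_le_nhds
    · filter_upwards [self_mem_nhdsWithin] with s hs using hmem c hc s hs
  have htop : ∀ c : ℝ, 0 < c → Tendsto (fun s : ℝ => c * s) atTop atTop :=
    fun c hc => tendsto_id.const_mul_atTop hc
  set F : ℝ → ℝ := fun s => φ₁ (a * s) + ε * φ₂ (b * s) with hF
  have hsub : ∀ {s t : ℝ}, s ∈ Ioi (0 : ℝ) → t ∈ Ioi (0 : ℝ) → uIcc s t ⊆ Ioi 0 :=
    fun hs ht => ordConnected_Ioi.uIcc_subset hs ht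
  have key : ∀ s t : ℝ, 0 < s → 0 < t → ContinuousOn F (Ioi 0) → InjOn F (Ioi 0) →
      F s < 1 → 1 < F t → ∃! s : ℝ, 0 < s ∧ F s = 1 := by
    intro s t hs ht hc hinj h1 h2
    obtain ⟨r, hr, hr1⟩ := intermediate_value_uIcc (hc.mono (hsub hs ht))
      (mem_uIcc.2 (Or.inl ⟨h1.le, h2.le⟩) : (1 : ℝ) ∈ uIcc (F s) (F t))
    refine ⟨r, ⟨hsub hs ht hr, hr1⟩, ?_⟩
    rintro y ⟨hy, hy1⟩
    exact hinj hy (hsub hs ht hr) (hy1.trans hr1.symm)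
  rcases hφ with ⟨h1, h2⟩ | ⟨h1, h2⟩
  · have hc : ContinuousOn F (Ioi 0) :=
      (h1.cont.comp (continuous_const.mul continuous_id).continuousOn (hmem a ha)).add
        (continuousOn_const.mul
          (h2.cont.comp (continuous_const.mul continuous_id).continuousOn (hmem b hb)))
    have hm : StrictMonoOn F (Ioi 0) := by
      intro s hs t ht hst
      have e1 := h1.mono (hmem a ha s hs) (hmem a ha t ht) (mul_lt_mul_of_pos_left hst ha)
      have e2 := h2.mono (hmem b hb s hs) (hmem b hb t ht) (mul_lt_mul_of_pos_left hst hb)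
      exact add_lt_add e1 (mul_lt_mul_of_pos_left e2 hε)
    have l0 : Tendsto F (𝓝[>] 0) (𝓝 (0 + ε * 0)) :=
      (h1.zero.comp (hzero a ha)).add ((h2.zero.comp (hzero b hb)).const_mul ε)
    have l1 : Tendsto F atTop atTop :=
      (h1.top.comp (htop a ha)).atTop_add_atTop
        ((h2.top.comp (htop b hb)).const_mul_atTop hε)
    obtain ⟨s, hs, hs0⟩ := ((l0.eventually (gt_mem_nhds (by simp : (0 : ℝ) + ε * 0 < 1))).and
      (self_mem_nhdsWithin : Ioi (0 : ℝ) ∈ 𝓝[>] (0 : ℝ))).exists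
    obtain ⟨t, ht, ht0⟩ := ((l1.eventually (eventually_gt_atTop 1)).and
      (eventually_gt_atTop 0)).exists
    exact key s t hs0 ht0 hc hm.injOn hs ht
  · have hc : ContinuousOn F (Ioi 0) :=
      (h1.cont.comp (continuous_const.mul continuous_id).continuousOn (hmem a ha)).add
        (continuousOn_const.mul
          (h2.cont.comp (continuous_const.mul continuous_id).continuousOn (hmem b hb)))
    have hm : StrictAntiOn F (Ioi 0) := by
      intro s hs t ht hst
      have e1 := h1.anti (hmem a ha s hs) (hmem a ha t ht) (mul_lt_mul_of_pos_left hst ha)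
      have e2 := h2.anti (hmem b hb s hs) (hmem b hb t ht) (mul_lt_mul_of_pos_left hst hb)
      exact add_lt_add e1 (mul_lt_mul_of_pos_left e2 hε)
    have l0 : Tendsto F (𝓝[>] 0) atTop :=
      (h1.zero.comp (hzero a ha)).atTop_add_atTop
        ((h2.zero.comp (hzero b hb)).const_mul_atTop hε)
    have l1 : Tendsto F atTop (𝓝 (0 + ε * 0)) :=
      (h1.top.comp (htop a ha)).add ((h2.top.comp (htop b hb)).const_mul ε)
    obtain ⟨t, ht, ht0⟩ := ((l0.eventually (eventually_gt_atTop 1)).and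
      (self_mem_nhdsWithin : Ioi (0 : ℝ) ∈ 𝓝[>] (0 : ℝ))).exists
    obtain ⟨s, hs, hs0⟩ := ((l1.eventually (gt_mem_nhds (by simp : (0 : ℝ) + ε * 0 < 1))).and
      (eventually_gt_atTop 0)).exists
    exact key s t hs0 ht0 hc hm.injOn hs ht

end DualOrlicz

end

noncomputable section

namespace DualOrlicz

/-- **Danskin's theorem** for a one-sided uniform first order expansion: the supremum over a
compact set is differentiable from the right when the maximiser is unique. -/
theorem hasDerivWithinAt_iSup_of_unique_max {X : Type*} [TopologicalSpace X] {Ω : Set X}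
    (hΩ : IsCompact Ω) {A : ℝ → X → ℝ} {b : X → ℝ} (ha : ContinuousOn (A 0) Ω)
    (hb : ContinuousOn b Ω) {w : X} (hw : w ∈ Ω) (hmax : ∀ y ∈ Ω, A 0 y ≤ A 0 w)
    (huniq : ∀ y ∈ Ω, A 0 y = A 0 w → y = w)
    (hexp : ∀ δ > 0, ∀ᶠ ε in 𝓝[>] (0 : ℝ), ∀ y ∈ Ω, |A ε y - A 0 y - ε * b y| ≤ δ * ε) :
    HasDerivWithinAt (fun ε => ⨆ y : Ω, A ε y) (b w) (Ioi 0) 0 := by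
  have : Nonempty Ω := ⟨⟨w, hw⟩⟩
  have hsup0 : ⨆ y : Ω, A 0 y = A 0 w :=
    le_antisymm (ciSup_le fun y => hmax y y.2)
      (le_ciSup (f := fun y : Ω => A 0 y) ⟨A 0 w, by rintro _ ⟨y, rfl⟩; exact hmax y y.2⟩ ⟨w, hw⟩)
  rw [hasDerivWithinAt_iff_tendsto_slope' (by simp), Metric.tendsto_nhds]
  intro δ' hδ'
  obtain ⟨δ, hδ, hδδ⟩ : ∃ δ > 0, 2 * δ < δ' := ⟨δ' / 3, by positivity, by linarith⟩
  obtain ⟨B, hB⟩ : ∃ B, ∀ y ∈ Ω, b y ≤ B := by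
    obtain ⟨B, hB⟩ := hΩ.bddAbove_image hb
    exact ⟨B, fun y hy => hB (mem_image_of_mem b hy)⟩
  have hgap : ∃ η > 0, ∀ y ∈ Ω, b w + δ ≤ b y → A 0 y ≤ A 0 w - η := by
    have hU : IsCompact (Ω ∩ b ⁻¹' Ici (b w + δ)) := by
      obtain ⟨C, hC, hCe⟩ := continuousOn_iff_isClosed.1 hb _ (isClosed_Ici (a := b w + δ))
      rw [inter_comm, hCe, inter_comm]
      exact hΩ.inter_right hC
    rcases (Ω ∩ b ⁻¹' Ici (b w + δ)).eq_empty_or_nonempty with he | hne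
    · refine ⟨1, one_pos, fun y hy hby => ?_⟩
      exact absurd (show y ∈ Ω ∩ b ⁻¹' Ici (b w + δ) from ⟨hy, hby⟩) (by simp [he])
    · obtain ⟨z, hz, hzmax⟩ := hU.exists_isMaxOn hne (ha.mono inter_subset_left)
      have hlt : A 0 z < A 0 w := by
        refine lt_of_le_of_ne (hmax z hz.1) fun h => ?_
        have h2 : b w + δ ≤ b z := hz.2
        rw [huniq z hz.1 h] at h2
        linarith
      refine ⟨A 0 w - A 0 z, sub_pos.2 hlt, fun y hy hby => ?_⟩
      have := hzmax (show y ∈ Ω ∩ b ⁻¹' Ici (b w + δ) from ⟨hy, hby⟩)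
      simp only [mem_ofPred_eq] at this
      linarith
  obtain ⟨η, hη, hgap⟩ := hgap
  have hsmall : ∀ᶠ ε in 𝓝[>] (0 : ℝ), ε * (B - b w) < η := by
    have : Tendsto (fun ε : ℝ => ε * (B - b w)) (𝓝[>] 0) (𝓝 0) := by
      have h1 : Tendsto (fun ε : ℝ => ε * (B - b w)) (𝓝 0) (𝓝 (0 * (B - b w))) :=
        (continuous_id.mul continuous_const).tendsto 0
      rw [zero_mul] at h1
      exact h1.mono_left nhdsWithin_le_nhds
    exact this.eventually (gt_mem_nhds hη)
  filter_upwards [hexp δ hδ, hsmall, self_mem_nhdsWithin] with ε hε hεs hε0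
  have hε0' : 0 < ε := hε0
  have hle : ∀ y ∈ Ω, A ε y ≤ A 0 w + ε * (b w + 2 * δ) := by
    intro y hy
    have h1 := (abs_le.1 (hε y hy)).2
    rcases le_total (b w + δ) (b y) with h | h
    · have h2 := hgap y hy h
      have h3 := mul_le_mul_of_nonneg_left (hB y hy) hε0'.le
      nlinarith
    · have h2 := hmax y hy
      have h3 := mul_le_mul_of_nonneg_left h hε0'.le
      nlinarith
  have hup : ⨆ y : Ω, A ε y ≤ A 0 w + ε * (b w + 2 * δ) := ciSup_le fun y => hle y y.2
  have hlow : A 0 w + ε * (b w - δ) ≤ ⨆ y : Ω, A ε y := by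
    refine le_trans ?_ (le_ciSup (f := fun y : Ω => A ε y)
      ⟨A 0 w + ε * (b w + 2 * δ), by rintro _ ⟨y, rfl⟩; exact hle y y.2⟩ ⟨w, hw⟩)
    have h1 := (abs_le.1 (hε w hw)).1
    simp only
    nlinarith
  rw [slope_def_field, hsup0, sub_zero, Real.dist_eq]
  refine lt_of_le_of_lt (abs_le.2 ⟨?_, ?_⟩) hδδ
  · rw [neg_le_sub_iff_le_add, ← sub_le_iff_le_add, le_div_iff₀ hε0']
    nlinarith
  · rw [sub_le_iff_le_add, div_le_iff₀ hε0']
    nlinarith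

/-- Comparison of suprema of two bounded families. -/
theorem abs_ciSup_sub_ciSup_le {ι : Type*} [Nonempty ι] {f g : ι → ℝ} {C : ℝ}
    (hf : BddAbove (range f)) (hg : BddAbove (range g)) (h : ∀ i, |f i - g i| ≤ C) :
    |(⨆ i, f i) - ⨆ i, g i| ≤ C := by
  rw [abs_le, neg_le_sub_iff_le_add, sub_le_iff_le_add]
  constructor
  · refine ciSup_le fun i => ?_
    have := (abs_le.1 (h i)).1
    have := le_ciSup hf i
    linarith
  · refine ciSup_le fun i => ?_
    have := (abs_le.1 (h i)).2
    have := le_ciSup hg i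
    linarith

/-- A solution of `φ₁ a + ε φ₂ (k a) = 1` satisfies `φ₂ (k a) ≤ φ₂ k`. -/
theorem orlicz_apply_le {φ₁ φ₂ : ℝ → ℝ}
    (hφ : (IsClassI φ₁ ∧ IsClassI φ₂) ∨ (IsClassD φ₁ ∧ IsClassD φ₂))
    {a k ε : ℝ} (ha : 0 < a) (hk : 0 < k) (hε : 0 < ε) (h : φ₁ a + ε * φ₂ (k * a) = 1) :
    0 < φ₂ (k * a) ∧ φ₂ (k * a) ≤ φ₂ k := by
  have hka := mul_pos hk ha
  rcases hφ with ⟨h1, h2⟩ | ⟨h1, h2⟩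
  · have hp := h2.pos _ hka
    have : φ₁ a < φ₁ 1 := by rw [h1.one]; nlinarith
    have ha1 := (h1.mono.lt_iff_lt ha (mem_Ioi.2 one_pos)).1 this
    exact ⟨hp, h2.mono.monotoneOn hka hk (by nlinarith)⟩
  · have hp := h2.pos _ hka
    have : φ₁ a < φ₁ 1 := by rw [h1.one]; nlinarith
    have ha1 := (h1.anti.lt_iff_gt ha (mem_Ioi.2 one_pos)).1 this
    exact ⟨hp, h2.anti.antitoneOn hk hka (by nlinarith)⟩

/-- Solutions of `φ₁ a + ε φ₂ (k a) = 1` tend to `1`, uniformly in `k`. -/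
theorem orlicz_eventually_abs_sub_one_lt {φ₁ φ₂ : ℝ → ℝ}
    (hφ : (IsClassI φ₁ ∧ IsClassI φ₂) ∨ (IsClassD φ₁ ∧ IsClassD φ₂))
    {S : Set ℝ} (hS : ∀ k ∈ S, 0 < k) {C : ℝ} (hC : ∀ k ∈ S, φ₂ k ≤ C) {η : ℝ} (hη : 0 < η) :
    ∀ᶠ ε in 𝓝[>] (0 : ℝ), ∀ k ∈ S, ∀ a, 0 < a → φ₁ a + ε * φ₂ (k * a) = 1 → |a - 1| < η := by
  have hsmall : ∀ r : ℝ, 0 < r → ∀ᶠ ε in 𝓝[>] (0 : ℝ), ε * C < r := by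
    intro r hr
    have h1 : Tendsto (fun ε : ℝ => ε * C) (𝓝 0) (𝓝 (0 * C)) :=
      (continuous_id.mul continuous_const).tendsto 0
    rw [zero_mul] at h1
    exact (h1.mono_left nhdsWithin_le_nhds).eventually (gt_mem_nhds hr)
  rcases id hφ with ⟨h1, h2⟩ | ⟨h1, h2⟩
  · set b := max (1 - η) (1 / 2) with hb
    have hb0 : 0 < b := lt_max_of_lt_right (by norm_num)
    have hb1 : b < 1 := max_lt (by linarith) (by norm_num)
    have hlt : φ₁ b < 1 := by
      rw [← h1.one]; exact h1.mono hb0 (mem_Ioi.2 one_pos) hb1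
    filter_upwards [hsmall _ (sub_pos.2 hlt), self_mem_nhdsWithin] with ε hε hε0 k hk a ha h
    have hε0' : 0 < ε := hε0
    obtain ⟨hp, hle⟩ := orlicz_apply_le hφ ha (hS k hk) hε0' h
    have hm := mul_le_mul_of_nonneg_left (hle.trans (hC k hk)) hε0'.le
    have hpp := mul_pos hε0' hp
    have ha1 : a < 1 := (h1.mono.lt_iff_lt ha (mem_Ioi.2 one_pos)).1 (by rw [h1.one]; linarith)
    have hba : b < a := (h1.mono.lt_iff_lt hb0 ha).1 (by linarith)
    have := le_max_left (1 - η) (1 / 2)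
    rw [abs_lt]
    constructor <;> linarith
  · have hb0 : 0 < 1 + η := by linarith
    have hlt : φ₁ (1 + η) < 1 := by
      have := h1.anti (mem_Ioi.2 one_pos) hb0 (by linarith)
      rwa [h1.one] at this
    filter_upwards [hsmall _ (sub_pos.2 hlt), self_mem_nhdsWithin] with ε hε hε0 k hk a ha h
    have hε0' : 0 < ε := hε0
    obtain ⟨hp, hle⟩ := orlicz_apply_le hφ ha (hS k hk) hε0' h
    have hm := mul_le_mul_of_nonneg_left (hle.trans (hC k hk)) hε0'.le
    have hpp := mul_pos hε0' hp
    have ha1 : 1 < a := (h1.anti.lt_iff_gt ha (mem_Ioi.2 one_pos)).1 (by rw [h1.one]; linarith)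
    have hba : a < 1 + η := (h1.anti.lt_iff_gt hb0 ha).1 (by linarith)
    rw [abs_lt]
    constructor <;> linarith

/-- First order expansion, uniform in `k ∈ [p, q]`, of the solution of
`φ₁ a + ε φ₂ (k a) = 1`. -/
theorem orlicz_expansion {φ₁ φ₂ : ℝ → ℝ}
    (hφ : (IsClassI φ₁ ∧ IsClassI φ₂) ∨ (IsClassD φ₁ ∧ IsClassD φ₂))
    {d : ℝ} (hd : HasDerivAt φ₁ d 1) (hd0 : d ≠ 0) {p q : ℝ} (hp : 0 < p)
    {δ : ℝ} (hδ : 0 < δ) :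
    ∀ᶠ ε in 𝓝[>] (0 : ℝ), ∀ k ∈ Icc p q, ∀ a, 0 < a → φ₁ a + ε * φ₂ (k * a) = 1 →
      |a - 1 + ε * (φ₂ k / d)| ≤ δ * ε := by
  have hone : φ₁ 1 = 1 := by rcases hφ with h | h <;> exact h.1.one
  have hcont : ContinuousOn φ₂ (Ioi 0) := by rcases hφ with h | h <;> exact h.2.cont
  have hS : ∀ k ∈ Icc p q, 0 < k := fun k hk => hp.trans_le hk.1
  obtain ⟨C, hC0, hC⟩ : ∃ C > 0, ∀ k ∈ Icc p q, φ₂ k ≤ C := by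
    obtain ⟨C, hC⟩ := isCompact_Icc.bddAbove_image (hcont.mono fun k hk => hS k hk)
    exact ⟨max C 1, by positivity, fun k hk => (hC (mem_image_of_mem φ₂ hk)).trans (le_max_left _ _)⟩
  have hdp : 0 < |d| := abs_pos.2 hd0
  set γ := min (|d| / 2) (δ * |d| * |d| / (4 * C)) with hγ
  have hγ0 : 0 < γ := lt_min (by positivity) (by positivity)
  obtain ⟨η₁, hη₁, H1⟩ : ∃ η > 0, ∀ a, |a - 1| < η → |φ₁ a - 1 - d * (a - 1)| ≤ γ * |a - 1| := by
    have := (hasDerivAt_iff_isLittleO.1 hd).def hγ0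
    obtain ⟨η, hη, h⟩ := Metric.eventually_nhds_iff.1 this
    refine ⟨η, hη, fun a ha => ?_⟩
    have := h (y := a) (by rwa [Real.dist_eq])
    rw [Real.norm_eq_abs, Real.norm_eq_abs, hone, smul_eq_mul] at this
    rwa [mul_comm d]
  obtain ⟨η₂, hη₂, H2⟩ : ∃ η > 0, ∀ k ∈ Icc p q, ∀ a, |a - 1| < η →
      |φ₂ (k * a) - φ₂ k| ≤ δ * |d| / 2 := by
    have hu : UniformContinuousOn φ₂ (Icc (p / 2) (2 * q)) :=
      isCompact_Icc.uniformContinuousOn_of_continuous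
        (hcont.mono fun k hk => (half_pos hp).trans_le hk.1)
    obtain ⟨τ, hτ, h⟩ := Metric.uniformContinuousOn_iff.1 hu (δ * |d| / 2) (by positivity)
    refine ⟨min (1 / 2) (τ / (|q| + 1)), lt_min (by norm_num) (by positivity), fun k hk a ha => ?_⟩
    have hk0 := hS k hk
    have ha1 := abs_lt.1 (lt_of_lt_of_le ha (min_le_left _ _))
    have ha2 := lt_of_lt_of_le ha (min_le_right _ _)
    have hq : q = |q| := (abs_of_pos (hk0.trans_le hk.2)).symm
    refine le_of_lt ?_
    rw [← Real.dist_eq]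
    refine h _ ⟨?_, ?_⟩ _ ⟨?_, ?_⟩ ?_
    · nlinarith [hk.1]
    · nlinarith [hk.2]
    · linarith [hk.1]
    · linarith [hk.2]
    · rw [Real.dist_eq, show k * a - k = k * (a - 1) by ring, abs_mul, abs_of_pos hk0]
      rw [lt_div_iff₀ (by positivity)] at ha2
      calc k * |a - 1| ≤ |a - 1| * (|q| + 1) := by
            rw [mul_comm]
            exact mul_le_mul_of_nonneg_left (by linarith [hk.2]) (abs_nonneg _)
        _ < τ := ha2
  filter_upwards [orlicz_eventually_abs_sub_one_lt hφ hS hC (lt_min hη₁ hη₂),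
    self_mem_nhdsWithin] with ε hε hε0 k hk a ha h
  have hε0' : 0 < ε := hε0
  have hη := hε k hk a ha h
  have e1 := H1 a (hη.trans_le (min_le_left _ _))
  have e2 := H2 k hk a (hη.trans_le (min_le_right _ _))
  obtain ⟨hpos, hle⟩ := orlicz_apply_le hφ ha (hS k hk) hε0' h
  have hφa : φ₁ a - 1 = -(ε * φ₂ (k * a)) := by linarith
  have e3 : |d| * |a - 1| ≤ 2 * (ε * C) := by
    have t1 : |d * (a - 1)| ≤ |φ₁ a - 1| + |φ₁ a - 1 - d * (a - 1)| := by
      have := abs_sub (φ₁ a - 1) (φ₁ a - 1 - d * (a - 1))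
      rwa [sub_sub_cancel] at this
    have t2 : |φ₁ a - 1| ≤ ε * C := by
      rw [hφa, abs_neg, abs_of_pos (mul_pos hε0' hpos)]
      exact mul_le_mul_of_nonneg_left (hle.trans (hC k hk)) hε0'.le
    have t3 : γ * |a - 1| ≤ |d| / 2 * |a - 1| :=
      mul_le_mul_of_nonneg_right (min_le_left _ _) (abs_nonneg _)
    rw [abs_mul] at t1
    linarith
  have e4 : γ * |a - 1| ≤ δ * |d| / 2 * ε := by
    calc γ * |a - 1| ≤ δ * |d| * |d| / (4 * C) * |a - 1| :=
          mul_le_mul_of_nonneg_right (min_le_right _ _) (abs_nonneg _)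
      _ = δ * |d| / (4 * C) * (|d| * |a - 1|) := by ring
      _ ≤ δ * |d| / (4 * C) * (2 * (ε * C)) := mul_le_mul_of_nonneg_left e3 (by positivity)
      _ = δ * |d| / 2 * ε := by field_simp; ring
  have e5 : |d * (a - 1 + ε * (φ₂ k / d))| ≤ |d| * (δ * ε) := by
    have : d * (a - 1 + ε * (φ₂ k / d)) =
        -(φ₁ a - 1 - d * (a - 1)) - ε * (φ₂ (k * a) - φ₂ k) := by
      rw [hφa]; field_simp; ring
    rw [this]
    refine (abs_sub _ _).trans ?_
    rw [abs_neg, abs_mul, abs_of_pos hε0']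
    have := mul_le_mul_of_nonneg_left e2 hε0'.le
    linarith
  rw [abs_mul] at e5
  exact le_of_mul_le_mul_left e5 hdp

/-- Integration against a signed measure with density. -/
theorem integral_withDensityᵥ_eq {X : Type*} [MeasurableSpace X] {μ : Measure X}
    {f g : X → ℝ} (hf : Integrable f μ) (hg : AEStronglyMeasurable g μ) {C : ℝ}
    (hgC : ∀ᵐ x ∂μ, ‖g x‖ ≤ C) :
    VectorMeasure.integral (μ.withDensityᵥ f) g (ContinuousLinearMap.lsmul ℝ ℝ) =
      ∫ x, g x * f x ∂μ := by
  have key : ∀ f' : X → ℝ, Integrable f' μ →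
      ∃ _ : IsFiniteMeasure (μ.withDensity fun x => ENNReal.ofReal (f' x)),
      (μ.withDensity fun x => ENNReal.ofReal (f' x)).toSignedMeasure.Integrable g ∧
      VectorMeasure.integral (μ.withDensity fun x => ENNReal.ofReal (f' x)).toSignedMeasure g
        (ContinuousLinearMap.lsmul ℝ ℝ) = ∫ x, max (f' x) 0 * g x ∂μ := by
    intro f' hf'
    have hfin : IsFiniteMeasure (μ.withDensity fun x => ENNReal.ofReal (f' x)) :=
      isFiniteMeasure_withDensity_ofReal hf'.2
    have hac := withDensity_absolutelyContinuous μ (fun x => ENNReal.ofReal (f' x))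
    refine ⟨hfin, ?_, ?_⟩
    · rw [VectorMeasure.Integrable, Measure.variation_toSignedMeasure]
      exact Integrable.of_bound (hg.mono_ac hac) C (hac.ae_le hgC)
    · have hflip : (ContinuousLinearMap.lsmul ℝ ℝ : ℝ →L[ℝ] ℝ →L[ℝ] ℝ) =
          (ContinuousLinearMap.lsmul ℝ ℝ : ℝ →L[ℝ] ℝ →L[ℝ] ℝ).flip := by
        ext; simp
      rw [hflip, VectorMeasure.integral_toSignedMeasure,
        integral_withDensity_eq_integral_toReal_smul₀ hf'.aemeasurable.ennreal_ofReal
          (ae_of_all _ fun x => ENNReal.ofReal_lt_top)]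
      simp [ENNReal.toReal_ofReal']
  obtain ⟨i1, I1, E1⟩ := key f hf
  obtain ⟨i2, I2, E2⟩ := key (fun x => -f x) hf.neg
  have hb : ∀ f' : X → ℝ, Integrable f' μ → Integrable (fun x => max (f' x) 0 * g x) μ :=
    fun f' hf' => hf'.pos_part.mul_bdd hg hgC
  rw [withDensityᵥ_eq_withDensity_pos_part_sub_withDensity_neg_part hf,
    VectorMeasure.integral_sub_vectorMeasure I1 I2, E1, E2,
    ← integral_sub (hb _ hf) (hb (fun x => -f x) hf.neg)]
  refine integral_congr_ae (ae_of_all _ fun x => ?_)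
  simp only
  rw [← sub_mul, max_zero_sub_max_neg_zero_eq_self, mul_comm]

variable {n : ℕ}

/-- The gauge function of the Aleksandrov body: `x ↦ sup_{w ∈ Ω} ⟨x, w⟩ / h w`. -/
def aleksandrovGauge (Ω : Set (Sph n)) (h : Sph n → ℝ) (x : EuclideanSpace ℝ (Fin n)) : ℝ :=
  ⨆ w : Ω, ⟪x, ((w : Sph n) : EuclideanSpace ℝ (Fin n))⟫ / h w

theorem norm_coe_sph (v : Sph n) : ‖(v : EuclideanSpace ℝ (Fin n))‖ = 1 := by
  simp

theorem sph_ext_of_smul_eq {u w : Sph n} {a b : ℝ} (ha : 0 < a) (hb : 0 < b)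
    (h : a • (u : EuclideanSpace ℝ (Fin n)) = b • (w : EuclideanSpace ℝ (Fin n))) : u = w := by
  have hab : a = b := by
    have := congrArg norm h
    rwa [norm_smul, norm_smul, norm_coe_sph, norm_coe_sph, mul_one, mul_one,
      Real.norm_of_nonneg ha.le, Real.norm_of_nonneg hb.le] at this
  subst hab
  exact Subtype.ext (smul_right_injective _ ha.ne' h)

section Gauge

variable {Ω : Set (Sph n)} {h : Sph n → ℝ} {c : ℝ}

theorem inner_div_le (hc : 0 < c) (hh : ∀ w ∈ Ω, c ≤ h w) (x : EuclideanSpace ℝ (Fin n)) {w : Sph n}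
    (hw : w ∈ Ω) : |⟪x, (w : EuclideanSpace ℝ (Fin n))⟫ / h w| ≤ ‖x‖ / c := by
  have h0 := hc.trans_le (hh w hw)
  rw [abs_div, abs_of_pos h0]
  refine div_le_div₀ (norm_nonneg _) ?_ hc (hh w hw)
  simpa [norm_coe_sph] using abs_real_inner_le_norm x (w : EuclideanSpace ℝ (Fin n))

theorem bddAbove_range_inner_div (hc : 0 < c) (hh : ∀ w ∈ Ω, c ≤ h w)
    (x : EuclideanSpace ℝ (Fin n)) :
    BddAbove (range fun w : Ω => ⟪x, ((w : Sph n) : EuclideanSpace ℝ (Fin n))⟫ / h w) :=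
  ⟨‖x‖ / c, by rintro _ ⟨w, rfl⟩; exact (abs_le.1 (inner_div_le hc hh x w.2)).2⟩

theorem inner_div_le_gauge (hc : 0 < c) (hh : ∀ w ∈ Ω, c ≤ h w) (x : EuclideanSpace ℝ (Fin n))
    {w : Sph n} (hw : w ∈ Ω) :
    ⟪x, (w : EuclideanSpace ℝ (Fin n))⟫ / h w ≤ aleksandrovGauge Ω h x :=
  le_ciSup (bddAbove_range_inner_div hc hh x) ⟨w, hw⟩

theorem lipschitzWith_gauge (hne : Ω.Nonempty) (hc : 0 < c) (hh : ∀ w ∈ Ω, c ≤ h w) :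
    LipschitzWith (Real.toNNReal (1 / c)) (aleksandrovGauge Ω h) := by
  have : Nonempty Ω := hne.to_subtype
  refine LipschitzWith.of_dist_le_mul fun x y => ?_
  rw [Real.dist_eq, Real.coe_toNNReal _ (by positivity), dist_eq_norm]
  refine abs_ciSup_sub_ciSup_le (bddAbove_range_inner_div hc hh x)
    (bddAbove_range_inner_div hc hh y) fun w => ?_
  rw [← sub_div, ← inner_sub_left, one_div_mul_eq_div]
  exact inner_div_le hc hh _ w.2

theorem gauge_smul {r : ℝ} (hr : 0 ≤ r) (x : EuclideanSpace ℝ (Fin n)) :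
    aleksandrovGauge Ω h (r • x) = r * aleksandrovGauge Ω h x := by
  simp only [aleksandrovGauge, real_inner_smul_left, mul_div_assoc]
  exact (Real.mul_iSup_of_nonneg hr _).symm

theorem gauge_smul_inv {x : EuclideanSpace ℝ (Fin n)} (hx : 0 < aleksandrovGauge Ω h x) :
    aleksandrovGauge Ω h ((aleksandrovGauge Ω h x)⁻¹ • x) = 1 := by
  rw [gauge_smul (inv_nonneg.2 hx.le), inv_mul_cancel₀ hx.ne']

theorem mem_aleksandrovBody_iff (hne : Ω.Nonempty) (hc : 0 < c) (hh : ∀ w ∈ Ω, c ≤ h w)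
    {x : EuclideanSpace ℝ (Fin n)} :
    x ∈ aleksandrovBody Ω h ↔ aleksandrovGauge Ω h x ≤ 1 := by
  have : Nonempty Ω := hne.to_subtype
  simp only [aleksandrovBody, mem_iInter, mem_ofPred_eq]
  constructor
  · intro H
    exact ciSup_le fun w => (div_le_one (hc.trans_le (hh w w.2))).2 (H w w.2)
  · intro H w hw
    exact (div_le_one (hc.trans_le (hh w hw))).1 ((inner_div_le_gauge hc hh x hw).trans H)

theorem radialFn_aleksandrovBody (hne : Ω.Nonempty) (hc : 0 < c) (hh : ∀ w ∈ Ω, c ≤ h w) {v : Sph n}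
    (hv : 0 < aleksandrovGauge Ω h v) :
    radialFn (aleksandrovBody Ω h) v = (aleksandrovGauge Ω h v)⁻¹ := by
  have : {r : ℝ | 0 < r ∧ r • (v : EuclideanSpace ℝ (Fin n)) ∈ aleksandrovBody Ω h} =
      Ioc 0 (aleksandrovGauge Ω h v)⁻¹ := by
    ext r
    simp only [mem_ofPred_eq, mem_Ioc, mem_aleksandrovBody_iff hne hc hh]
    refine and_congr_right fun hr => ?_
    rw [gauge_smul hr.le, ← le_div_iff₀ hv, one_div]
  rw [radialFn, this, csSup_Ioc (inv_pos.2 hv)]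

theorem mem_frontier_aleksandrovBody_iff (hne : Ω.Nonempty) (hc : 0 < c) (hh : ∀ w ∈ Ω, c ≤ h w)
    {x : EuclideanSpace ℝ (Fin n)} :
    x ∈ frontier (aleksandrovBody Ω h) ↔ aleksandrovGauge Ω h x = 1 := by
  have hcont := (lipschitzWith_gauge hne hc hh).continuous
  have hset : aleksandrovBody Ω h = {x | aleksandrovGauge Ω h x ≤ 1} :=
    Set.ext fun _ => mem_aleksandrovBody_iff hne hc hh
  constructor
  · intro hx
    rw [hset] at hx
    exact frontier_le_subset_eq hcont continuous_const hx
  · intro hx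
    have hcl : IsClosed (aleksandrovBody Ω h) := by
      rw [hset]; exact isClosed_le hcont continuous_const
    refine hcl.frontier_eq ▸ ⟨(mem_aleksandrovBody_iff hne hc hh).2 hx.le, fun hint => ?_⟩
    have ht : Tendsto (fun r : ℝ => r • x) (𝓝[>] 1) (𝓝 x) := by
      have : Tendsto (fun r : ℝ => r • x) (𝓝 1) (𝓝 ((1 : ℝ) • x)) :=
        (continuous_id.smul continuous_const).tendsto 1
      rw [one_smul] at this
      exact this.mono_left nhdsWithin_le_nhds
    obtain ⟨r, hr, hr1⟩ := ((ht.eventually (mem_interior_iff_mem_nhds.1 hint)).and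
      self_mem_nhdsWithin).exists
    have hr1' : 1 < r := hr1
    have := (mem_aleksandrovBody_iff hne hc hh).1 hr
    rw [gauge_smul (by linarith), hx] at this
    linarith

theorem differentiableAt_gauge_of_smul {r : ℝ} (hr : 0 < r) {x : EuclideanSpace ℝ (Fin n)}
    (hd : DifferentiableAt ℝ (aleksandrovGauge Ω h) (r • x)) :
    DifferentiableAt ℝ (aleksandrovGauge Ω h) x := by
  have : aleksandrovGauge Ω h = fun y => r⁻¹ * aleksandrovGauge Ω h (r • y) := by
    ext y
    rw [gauge_smul hr.le, inv_mul_cancel_left₀ hr.ne']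
  rw [this]
  exact (DifferentiableAt.comp (𝕜 := ℝ) x hd (differentiableAt_id.const_smul r)).const_mul _

/-- By Rademacher's theorem the gauge is differentiable at almost every direction. -/
theorem ae_differentiableAt_gauge (hne : Ω.Nonempty) (hc : 0 < c) (hh : ∀ w ∈ Ω, c ≤ h w) :
    ∀ᵐ v : Sph n ∂(sphMeasure n), DifferentiableAt ℝ (aleksandrovGauge Ω h) v := by
  have hm : MeasurableSet {v : Sph n | ¬ DifferentiableAt ℝ (aleksandrovGauge Ω h) v} :=
    (measurable_subtype_coe (measurableSet_of_differentiableAt ℝ (aleksandrovGauge Ω h))).compl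
  rw [ae_iff, sphMeasure, Measure.toSphere_apply' _ hm]
  refine mul_eq_zero_of_right _ (measure_mono_null ?_
    (ae_iff.1 (lipschitzWith_gauge hne hc hh).ae_differentiableAt))
  rintro _ ⟨r, hr, _, ⟨v, hv, rfl⟩, rfl⟩
  exact fun hd => hv (differentiableAt_gauge_of_smul hr.1 hd)

theorem eq_of_subgradients {E : Type*} [NormedAddCommGroup E] [InnerProductSpace ℝ E] {M : E → ℝ}
    {x p q : E} (hd : DifferentiableAt ℝ M x)
    (hp : ∀ y, ⟪y, p⟫ ≤ M y) (hpx : ⟪x, p⟫ = M x) (hq : ∀ y, ⟪y, q⟫ ≤ M y) (hqx : ⟪x, q⟫ = M x) :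
    p = q := by
  have key : ∀ r : E, (∀ y, ⟪y, r⟫ ≤ M y) → ⟪x, r⟫ = M x → fderiv ℝ M x = innerSL ℝ r := by
    intro r hr hrx
    have hmin : IsLocalMin (fun y => M y - innerSL ℝ r y) x := by
      refine Eventually.of_forall fun y => ?_
      have := hr y
      simp only [innerSL_apply_apply, real_inner_comm _ r, hrx, sub_self]
      rw [real_inner_comm] at this
      rw [real_inner_comm]
      linarith
    have := hmin.hasFDerivAt_eq_zero (hd.hasFDerivAt.sub (innerSL ℝ r).hasFDerivAt)
    exact sub_eq_zero.1 this
  have := (key p hp hpx).symm.trans (key q hq hqx)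
  refine ext_inner_right ℝ fun y => ?_
  simpa using DFunLike.congr_fun this y

theorem eq_of_gauge_eq {v : Sph n} (hd : DifferentiableAt ℝ (aleksandrovGauge Ω h) v)
    (hc : 0 < c) (hh : ∀ w ∈ Ω, c ≤ h w) {w : Sph n} (hw : w ∈ Ω)
    (hwv : ⟪(v : EuclideanSpace ℝ (Fin n)), (w : EuclideanSpace ℝ (Fin n))⟫ / h w =
      aleksandrovGauge Ω h v)
    {u : Sph n} {a : ℝ} (ha : 0 < a)
    (hu : ∀ y, ⟪y, (u : EuclideanSpace ℝ (Fin n))⟫ / a ≤ aleksandrovGauge Ω h y)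
    (huv : ⟪(v : EuclideanSpace ℝ (Fin n)), (u : EuclideanSpace ℝ (Fin n))⟫ / a =
      aleksandrovGauge Ω h v) : u = w := by
  have hw0 := hc.trans_le (hh w hw)
  refine sph_ext_of_smul_eq (inv_pos.2 ha) (inv_pos.2 hw0)
    (eq_of_subgradients hd (fun y => ?_) ?_ (fun y => ?_) ?_)
  · rw [real_inner_smul_right, inv_mul_eq_div]; exact hu y
  · rw [real_inner_smul_right, inv_mul_eq_div]; exact huv
  · rw [real_inner_smul_right, inv_mul_eq_div]; exact inner_div_le_gauge hc hh y hw
  · rw [real_inner_smul_right, inv_mul_eq_div]; exact hwv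

theorem exists_gauge_eq (hΩ : IsClosed Ω) (hne : Ω.Nonempty) (hh : IsCPos Ω h) (hc : 0 < c)
    (hhc : ∀ w ∈ Ω, c ≤ h w) (v : Sph n) :
    ∃ w ∈ Ω, ⟪(v : EuclideanSpace ℝ (Fin n)), (w : EuclideanSpace ℝ (Fin n))⟫ / h w =
      aleksandrovGauge Ω h v := by
  have : Nonempty Ω := hne.to_subtype
  obtain ⟨w, hw, hmax⟩ := hΩ.isCompact.exists_isMaxOn hne
    (f := fun w : Sph n =>
      ⟪(v : EuclideanSpace ℝ (Fin n)), (w : EuclideanSpace ℝ (Fin n))⟫ / h w)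
    (ContinuousOn.div (by fun_prop) hh.1 fun w hw => (hh.2 w hw).ne')
  exact ⟨w, hw, le_antisymm (inner_div_le_gauge hc hhc _ hw) (ciSup_le fun y => hmax y.2)⟩

end Gauge

theorem IsAdmissibleDomain.nonempty (hn : 0 < n) {Ω : Set (Sph n)} (hΩ : IsAdmissibleDomain Ω) :
    Ω.Nonempty := by
  by_contra hne
  rw [not_nonempty_iff_eq_empty] at hne
  exact hΩ.2 ⟨EuclideanSpace.single ⟨0, hn⟩ 1, by simp⟩ (by simp [hne])

theorem IsAdmissibleDomain.gauge_pos {Ω : Set (Sph n)} (hΩ : IsAdmissibleDomain Ω)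
    {h : Sph n → ℝ} {c : ℝ} (hc : 0 < c) (hh : ∀ w ∈ Ω, c ≤ h w) (v : Sph n) :
    0 < aleksandrovGauge Ω h v := by
  obtain ⟨w, hw, hwv⟩ := not_subset.1 (hΩ.2 (-v))
  simp only [mem_ofPred_eq, not_le] at hwv
  have hwv' : 0 < ⟪(v : EuclideanSpace ℝ (Fin n)), (w : EuclideanSpace ℝ (Fin n))⟫ := by
    rw [real_inner_comm]
    simpa using hwv
  exact (div_pos hwv' (hc.trans_le (hh w hw))).trans_le (inner_div_le_gauge hc hh _ hw)

theorem IsAdmissibleDomain.exists_gauge_lower_bound (hn : 0 < n) {Ω : Set (Sph n)}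
    (hΩ : IsAdmissibleDomain Ω) {h : Sph n → ℝ} {c : ℝ} (hc : 0 < c) (hh : ∀ w ∈ Ω, c ≤ h w) :
    ∃ m > 0, ∀ v : Sph n, m ≤ aleksandrovGauge Ω h v := by
  have hne := hΩ.nonempty hn
  obtain ⟨z, -, hz⟩ := (isCompact_univ (X := Sph n)).exists_isMinOn (hne.mono (subset_univ _))
    ((lipschitzWith_gauge hne hc hh).continuous.comp continuous_subtype_val).continuousOn
  exact ⟨aleksandrovGauge Ω h z, hΩ.gauge_pos hc hh z, fun v => hz (mem_univ v)⟩

theorem IsCPos.exists_lower_bound {Ω : Set (Sph n)} (hΩ : IsClosed Ω) {h : Sph n → ℝ}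
    (hh : IsCPos Ω h) : ∃ c > 0, ∀ w ∈ Ω, c ≤ h w := by
  rcases Ω.eq_empty_or_nonempty with rfl | hne
  · exact ⟨1, one_pos, by simp⟩
  · obtain ⟨w, hw, hmin⟩ := hΩ.isCompact.exists_isMinOn hne hh.1
    exact ⟨h w, hh.2 w hw, fun y hy => hmin hy⟩

section Selection

variable {Ω : Set (Sph n)} {h : Sph n → ℝ} {c : ℝ} {T : Sph n → Sph n}

/-- A selection of the maximisers is continuous where the maximiser is unique. -/
theorem continuousAt_of_isMax (hΩ : IsClosed Ω) (hne : Ω.Nonempty) (hcont : ContinuousOn h Ω)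
    (hc : 0 < c) (hhc : ∀ w ∈ Ω, c ≤ h w) (hT : ∀ v, T v ∈ Ω)
    (hTv : ∀ v : Sph n, ⟪(v : EuclideanSpace ℝ (Fin n)),
      (T v : EuclideanSpace ℝ (Fin n))⟫ / h (T v) = aleksandrovGauge Ω h v)
    {v : Sph n} (hd : DifferentiableAt ℝ (aleksandrovGauge Ω h) v) : ContinuousAt T v := by
  refine hΩ.isCompact.tendsto_nhds_of_unique_mapClusterPt (Eventually.of_forall hT) ?_
  intro y hy hcl
  obtain ⟨U, hU, hUy⟩ := mapClusterPt_iff_ultrafilter.1 hcl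
  have hlimh : Tendsto (fun v' => h (T v')) U (𝓝 (h y)) :=
    (hcont y hy).tendsto.comp (tendsto_nhdsWithin_iff.2 ⟨hUy, Eventually.of_forall hT⟩)
  have hv : Tendsto (fun v' : Sph n => (v' : EuclideanSpace ℝ (Fin n))) U (𝓝 v) :=
    (continuous_subtype_val.tendsto v).mono_left hU
  have h1 : Tendsto (fun v' : Sph n => ⟪(v' : EuclideanSpace ℝ (Fin n)),
      (T v' : EuclideanSpace ℝ (Fin n))⟫ / h (T v')) U
      (𝓝 (⟪(v : EuclideanSpace ℝ (Fin n)), (y : EuclideanSpace ℝ (Fin n))⟫ / h y)) :=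
    (hv.inner ((continuous_subtype_val.tendsto y).comp hUy)).div hlimh
      (hc.trans_le (hhc y hy)).ne'
  have h2 : Tendsto (fun v' : Sph n => aleksandrovGauge Ω h v') U (𝓝 (aleksandrovGauge Ω h v)) :=
    ((lipschitzWith_gauge hne hc hhc).continuous.tendsto _).comp hv
  simp only [hTv] at h1
  exact eq_of_gauge_eq hd hc hhc (hT v) (hTv v) (hc.trans_le (hhc y hy))
    (fun z => inner_div_le_gauge hc hhc z hy) (tendsto_nhds_unique h1 h2)

theorem aemeasurable_of_isMax (hΩ : IsClosed Ω) (hne : Ω.Nonempty) (hcont : ContinuousOn h Ω)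
    (hc : 0 < c) (hhc : ∀ w ∈ Ω, c ≤ h w) (hT : ∀ v, T v ∈ Ω)
    (hTv : ∀ v : Sph n, ⟪(v : EuclideanSpace ℝ (Fin n)),
      (T v : EuclideanSpace ℝ (Fin n))⟫ / h (T v) = aleksandrovGauge Ω h v) :
    AEMeasurable T (sphMeasure n) := by
  have hm : MeasurableSet {v : Sph n | DifferentiableAt ℝ (aleksandrovGauge Ω h) v} :=
    measurable_subtype_coe (measurableSet_of_differentiableAt ℝ (aleksandrovGauge Ω h))
  have hr : (sphMeasure n).restrict {v : Sph n | DifferentiableAt ℝ (aleksandrovGauge Ω h) v} =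
      sphMeasure n := Measure.restrict_eq_self_of_ae_mem (ae_differentiableAt_gauge hne hc hhc)
  rw [← hr]
  exact ContinuousOn.aemeasurable (fun v hv =>
    (continuousAt_of_isMax hΩ hne hcont hc hhc hT hTv hv).continuousWithinAt) hm

/-- At a direction where the gauge is differentiable, membership in the reverse radial Gauss
image is decided by the maximiser. -/
theorem mem_reverseRadialGaussImage_iff (hn : 0 < n) (hΩ : IsAdmissibleDomain Ω)
    (hc : 0 < c) (hhc : ∀ w ∈ Ω, c ≤ h w) (hT : ∀ v, T v ∈ Ω)
    (hTv : ∀ v : Sph n, ⟪(v : EuclideanSpace ℝ (Fin n)),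
      (T v : EuclideanSpace ℝ (Fin n))⟫ / h (T v) = aleksandrovGauge Ω h v)
    {v : Sph n} (hd : DifferentiableAt ℝ (aleksandrovGauge Ω h) v) (E : Set (Sph n)) :
    v ∈ reverseRadialGaussImage (aleksandrovBody Ω h) E ↔ T v ∈ E := by
  have hne := hΩ.nonempty hn
  set M := aleksandrovGauge Ω h with hM
  have hpos : ∀ y : EuclideanSpace ℝ (Fin n), y ≠ 0 → 0 < M y := by
    intro y hy
    have hy0 := norm_pos_iff.2 hy
    have h1 := hΩ.gauge_pos hc hhc ⟨‖y‖⁻¹ • y, by simp [norm_smul, hy0.ne']⟩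
    simp only at h1
    rw [gauge_smul (inv_nonneg.2 hy0.le)] at h1
    exact pos_of_mul_pos_right h1 (inv_nonneg.2 hy0.le)
  have hM0 : M 0 = 0 := by
    have := gauge_smul (Ω := Ω) (h := h) le_rfl (0 : EuclideanSpace ℝ (Fin n))
    simpa using this
  constructor
  · rintro ⟨u, huE, x, ⟨hxf, hxs⟩, hvx⟩
    have hx1 : M x = 1 := (mem_frontier_aleksandrovBody_iff hne hc hhc).1 hxf
    have hx0 : x ≠ 0 := by rintro rfl; rw [hM0] at hx1; exact zero_ne_one hx1
    have hxn := norm_pos_iff.2 hx0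
    set a := supportFn (aleksandrovBody Ω h) u with ha
    have hxu : ⟪x, (u : EuclideanSpace ℝ (Fin n))⟫ = a := hxs
    have hbdd : BddAbove ((fun x => ⟪(u : EuclideanSpace ℝ (Fin n)), x⟫) ''
        aleksandrovBody Ω h) := by
      obtain ⟨m, hm, hmM⟩ := hΩ.exists_gauge_lower_bound hn hc hhc
      refine ⟨m⁻¹, ?_⟩
      rintro _ ⟨y, hy, rfl⟩
      have hy1 := (mem_aleksandrovBody_iff hne hc hhc).1 hy
      have hle : m * ‖y‖ ≤ 1 := by
        rcases eq_or_ne y 0 with rfl | hy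
        · simp
        · have hy0 := norm_pos_iff.2 hy
          have h1 := hmM ⟨‖y‖⁻¹ • y, by simp [norm_smul, hy0.ne']⟩
          simp only at h1
          rw [gauge_smul (inv_nonneg.2 hy0.le), inv_mul_eq_div, le_div_iff₀ hy0] at h1
          exact h1.trans hy1
      refine (real_inner_le_norm _ _).trans ?_
      rwa [norm_coe_sph, one_mul, ← one_div, le_div_iff₀' hm]
    have hsupp : ∀ y, M y ≤ 1 → ⟪y, (u : EuclideanSpace ℝ (Fin n))⟫ ≤ a := by
      intro y hy
      rw [real_inner_comm]
      exact le_csSup hbdd (mem_image_of_mem _ ((mem_aleksandrovBody_iff hne hc hhc).2 hy))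
    have hu0 : (u : EuclideanSpace ℝ (Fin n)) ≠ 0 := by
      rw [← norm_pos_iff, norm_coe_sph]; exact one_pos
    have ha0 : 0 < a := by
      have h1 := hsupp ((M u)⁻¹ • u) (gauge_smul_inv (hpos u hu0)).le
      rw [real_inner_smul_left, real_inner_self_eq_norm_sq, norm_coe_sph] at h1
      have := inv_pos.2 (hpos u hu0)
      linarith
    have hsub : ∀ y, ⟪y, (u : EuclideanSpace ℝ (Fin n))⟫ / a ≤ M y := by
      intro y
      rcases eq_or_ne y 0 with rfl | hy
      · simp [hM0]
      · have h1 := hsupp ((M y)⁻¹ • y) (gauge_smul_inv (hpos y hy)).le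
        rw [real_inner_smul_left, inv_mul_le_iff₀ (hpos y hy)] at h1
        rwa [div_le_iff₀ ha0]
    have huT : u = T v := by
      refine eq_of_gauge_eq hd hc hhc (hT v) (hTv v) ha0 hsub ?_
      change _ = M v
      rw [hvx, real_inner_smul_left, hxu, hM, gauge_smul (inv_nonneg.2 hxn.le), ← hM,
        hx1]
      field_simp
    rwa [← huT]
  · intro hE
    have hv0 : 0 < M v := hΩ.gauge_pos hc hhc v
    have hTpos := hc.trans_le (hhc (T v) (hT v))
    have hMx : M ((M v)⁻¹ • (v : EuclideanSpace ℝ (Fin n))) = 1 := gauge_smul_inv hv0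
    have hin : ⟪(M v)⁻¹ • (v : EuclideanSpace ℝ (Fin n)),
        (T v : EuclideanSpace ℝ (Fin n))⟫ = h (T v) := by
      rw [real_inner_smul_left, inv_mul_eq_iff_eq_mul₀ hv0.ne', ← hTv v,
        div_mul_cancel₀ _ hTpos.ne']
    have hxK := (mem_aleksandrovBody_iff hne hc hhc).2 hMx.le
    refine ⟨T v, hE, (M v)⁻¹ • (v : EuclideanSpace ℝ (Fin n)),
      ⟨(mem_frontier_aleksandrovBody_iff hne hc hhc).2 hMx, ?_⟩, ?_⟩
    · change ⟪_, _⟫ = supportFn _ _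
      have hg : IsGreatest ((fun x => ⟪(T v : EuclideanSpace ℝ (Fin n)), x⟫) ''
          aleksandrovBody Ω h) (h (T v)) := by
        refine ⟨⟨_, hxK, ?_⟩, ?_⟩
        · simp only
          rw [real_inner_comm, hin]
        · rintro _ ⟨y, hy, rfl⟩
          simp only
          rw [real_inner_comm]
          exact mem_iInter₂.1 hy (T v) (hT v)
      rw [supportFn, hg.csSup_eq, hin]
    · rw [norm_smul, norm_coe_sph, mul_one, norm_inv, inv_inv, Real.norm_of_nonneg hv0.le,
        smul_smul, mul_inv_cancel₀ hv0.ne', one_smul]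

end Selection

/-- The integral of `ψ` over `Ω` against the dual curvature measure, in terms of a map `T` that
describes the reverse radial Gauss images up to null sets. -/
theorem dualCurvatureMeasure_spec {G : ℝ → Sph n → ℝ} {K : Set (EuclideanSpace ℝ (Fin n))}
    {Ω : Set (Sph n)} (hΩ : IsClosed Ω) {T : Sph n → Sph n} (hTm : AEMeasurable T (sphMeasure n))
    (hT : ∀ v, T v ∈ Ω)
    (hα : ∀ E, reverseRadialGaussImage K E =ᵐ[sphMeasure n] T ⁻¹' E)
    (hint : Integrable (fun v => radialFn K v * partialT G (radialFn K v) v) (sphMeasure n)) :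
    (∀ E, MeasurableSet E → NullMeasurableSet (reverseRadialGaussImage K E) (sphMeasure n) ∧
      dualCurvatureMeasure G K E = dualCurvatureSetFn G K E) ∧
    ∀ ψ : Sph n → ℝ, ContinuousOn ψ Ω →
      VectorMeasure.integral ((dualCurvatureMeasure G K).restrict Ω) ψ
        (ContinuousLinearMap.lsmul ℝ ℝ) =
      (1 / (n : ℝ)) * ∫ v, ψ (T v) * (radialFn K v * partialT G (radialFn K v) v)
        ∂(sphMeasure n) := by
  set σ := sphMeasure n with hσ
  set f : Sph n → ℝ := fun v => (1 / (n : ℝ)) * (radialFn K v * partialT G (radialFn K v) v)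
    with hf
  have hfint : Integrable f σ := hint.const_mul _
  set T' := hTm.mk T with hT'
  have hT'm : Measurable T' := hTm.measurable_mk
  have hTT' : T =ᵐ[σ] T' := hTm.ae_eq_mk
  have hpre : ∀ E : Set (Sph n), T ⁻¹' E =ᵐ[σ] T' ⁻¹' E := fun E => by
    filter_upwards [hTT'] with v hv
    exact propext (show T v ∈ E ↔ T' v ∈ E by rw [hv])
  set ν := σ.withDensityᵥ f with hν
  have happly : ∀ E, MeasurableSet E → ν.map T' E = dualCurvatureSetFn G K E := by
    intro E hE
    rw [VectorMeasure.map_apply _ hT'm hE, withDensityᵥ_apply hfint (hT'm hE), dualCurvatureSetFn,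
      setIntegral_congr_set ((hα E).trans (hpre E)), ← integral_const_mul]
  have hex : ∃ μ : SignedMeasure (Sph n), ∀ E, MeasurableSet E → μ E = dualCurvatureSetFn G K E :=
    ⟨_, happly⟩
  have hspec : ∀ E, MeasurableSet E → dualCurvatureMeasure G K E = dualCurvatureSetFn G K E := by
    rw [dualCurvatureMeasure, dif_pos hex]
    exact hex.choose_spec
  refine ⟨fun E hE => ⟨((hT'm hE).nullMeasurableSet).congr ((hα E).trans (hpre E)).symm,
    hspec E hE⟩, fun ψ hψ => ?_⟩
  have hmem : ∀ᵐ v ∂σ, T' v ∈ Ω := by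
    filter_upwards [hTT'] with v hv
    rw [← hv]; exact hT v
  have hres : (dualCurvatureMeasure G K).restrict Ω = ν.map T' := by
    ext E hE
    rw [VectorMeasure.restrict_apply _ hΩ.measurableSet hE, hspec _ (hE.inter hΩ.measurableSet),
      ← happly _ (hE.inter hΩ.measurableSet), VectorMeasure.map_apply _ hT'm hE,
      VectorMeasure.map_apply _ hT'm (hE.inter hΩ.measurableSet), withDensityᵥ_apply hfint (hT'm hE),
      withDensityᵥ_apply hfint (hT'm (hE.inter hΩ.measurableSet))]
    refine setIntegral_congr_set ?_
    filter_upwards [hmem] with v hv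
    exact propext ⟨fun h => h.1, fun h => ⟨h, hv⟩⟩
  have hψm : AEStronglyMeasurable ψ (σ.map T') := by
    have : (σ.map T').restrict Ω = σ.map T' :=
      Measure.restrict_eq_self_of_ae_mem ((ae_map_iff hT'm.aemeasurable hΩ.measurableSet).2 hmem)
    rw [← this]
    exact hψ.aestronglyMeasurable hΩ.measurableSet
  have hψT : AEStronglyMeasurable (fun v => ψ (T' v)) σ := hψm.comp_measurable hT'm
  obtain ⟨C, hC⟩ : ∃ C, ∀ᵐ v ∂σ, ‖ψ (T' v)‖ ≤ C := by
    obtain ⟨C, hC⟩ := hΩ.isCompact.exists_bound_of_continuousOn hψ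
    exact ⟨C, hmem.mono fun v hv => hC _ hv⟩
  have hvar : ν.variation = σ.withDensity fun x => ‖f x‖ₑ :=
    Measure.variation_withDensityᵥ hfint
  have hac : ν.variation ≪ σ := hvar ▸ withDensity_absolutelyContinuous _ _
  have hfin : IsFiniteMeasure ν.variation := by
    rw [hvar]
    exact isFiniteMeasure_withDensity hfint.2.ne
  rw [hres, VectorMeasure.integral_map hT'm (hψm.mono_ac (hac.map hT'm))
    (Integrable.of_bound (hψT.mono_ac hac) C (hac.ae_le hC)),
    integral_withDensityᵥ_eq hfint hψT hC, ← integral_const_mul]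
  refine integral_congr_ae ?_
  filter_upwards [hTT'] with v hv
  simp only [hf, hv]
  ring

/-- Variational formula for the general dual volume of Aleksandrov bodies along a family
`h ε` with `h 0 / h ε = 1 - ε g + o(ε)` uniformly on `Ω`. -/
theorem tendsto_dualVolume (hn : 0 < n) {Ω : Set (Sph n)} (hΩ : IsAdmissibleDomain Ω)
    {h : ℝ → Sph n → ℝ} (hh : IsCPos Ω (h 0)) {g : Sph n → ℝ} (hg : ContinuousOn g Ω)
    (hpos : ∀ ε, 0 < ε → ∀ u ∈ Ω, 0 < h ε u)
    (hexp : ∀ δ > 0, ∀ᶠ ε in 𝓝[>] (0 : ℝ), ∀ u ∈ Ω, |h 0 u / h ε u - 1 + ε * g u| ≤ δ * ε)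
    {c : ℝ} (hc : 0 < c) (hhc : ∀ w ∈ Ω, c ≤ h 0 w)
    {T : Sph n → Sph n} (hT : ∀ v, T v ∈ Ω)
    (hTv : ∀ v : Sph n, ⟪(v : EuclideanSpace ℝ (Fin n)),
      (T v : EuclideanSpace ℝ (Fin n))⟫ / h 0 (T v) = aleksandrovGauge Ω (h 0) v)
    {G : ℝ → Sph n → ℝ}
    (hG : ContinuousOn (fun p : ℝ × Sph n => G p.1 p.2) (Ioi 0 ×ˢ univ))
    (hGdiff : ∀ t, 0 < t → ∀ u, DifferentiableAt ℝ (fun s => G s u) t)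
    (hGt : ContinuousOn (fun p : ℝ × Sph n => partialT G p.1 p.2) (Ioi 0 ×ˢ univ)) :
    Tendsto (fun ε => (dualVolume G (aleksandrovBody Ω (h ε)) -
        dualVolume G (aleksandrovBody Ω (h 0))) / ε) (𝓝[>] 0)
      (𝓝 (∫ v, g (T v) * (radialFn (aleksandrovBody Ω (h 0)) v *
        partialT G (radialFn (aleksandrovBody Ω (h 0)) v) v) ∂(sphMeasure n))) := by
  have hne := hΩ.nonempty hn
  have hNe : Nonempty Ω := hne.to_subtype
  set M : ℝ → Sph n → ℝ := fun ε v => aleksandrovGauge Ω (h ε) v with hM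
  obtain ⟨B, hB0, hB⟩ : ∃ B > 0, ∀ u ∈ Ω, |g u| ≤ B := by
    obtain ⟨B, hB⟩ := hΩ.1.isCompact.exists_bound_of_continuousOn hg
    exact ⟨max B 1, by positivity, fun u hu => (hB u hu).trans (le_max_left _ _)⟩
  have hlow : ∀ᶠ ε in 𝓝[>] (0 : ℝ), ∀ w ∈ Ω, c / 2 ≤ h ε w := by
    have hs : ∀ᶠ ε in 𝓝[>] (0 : ℝ), ε < 1 / (B + 1) :=
      nhdsWithin_le_nhds (gt_mem_nhds (by positivity))
    filter_upwards [hexp 1 one_pos, hs, self_mem_nhdsWithin] with ε hε hεs hε0 w hw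
    have hε0' : 0 < ε := hε0
    have h1 := (abs_le.1 (hε w hw)).2
    have h2 := mul_le_mul_of_nonneg_left (abs_le.1 (hB w hw)).1 hε0'.le
    rw [lt_div_iff₀ (by positivity)] at hεs
    have h3 : h 0 w / h ε w ≤ 2 := by linarith
    rw [div_le_iff₀ (hpos ε hε0' w hw)] at h3
    linarith [hhc w hw]
  have hterm : ∀ {ε : ℝ} (v w : Sph n), w ∈ Ω → 0 < ε →
      ⟪(v : EuclideanSpace ℝ (Fin n)), (w : EuclideanSpace ℝ (Fin n))⟫ / h ε w =
      ⟪(v : EuclideanSpace ℝ (Fin n)), (w : EuclideanSpace ℝ (Fin n))⟫ / h 0 w *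
        (h 0 w / h ε w) := by
    intro ε v w hw hε
    have h1 := (hpos ε hε w hw).ne'
    have h2 := (hh.2 w hw).ne'
    field_simp
  have hunit : ∀ v w : Sph n, w ∈ Ω →
      |⟪(v : EuclideanSpace ℝ (Fin n)), (w : EuclideanSpace ℝ (Fin n))⟫ / h 0 w| ≤ 1 / c := by
    intro v w hw
    have := inner_div_le hc hhc (v : EuclideanSpace ℝ (Fin n)) hw
    rwa [norm_coe_sph] at this
  obtain ⟨C, hC0, hC⟩ : ∃ C > 0, ∀ᶠ ε in 𝓝[>] (0 : ℝ), ∀ v, |M ε v - M 0 v| ≤ C * ε := by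
    refine ⟨1 / c * (1 + B), by positivity, ?_⟩
    filter_upwards [hexp 1 one_pos, hlow, self_mem_nhdsWithin] with ε hε hl hε0 v
    have hε0' : 0 < ε := hε0
    refine abs_ciSup_sub_ciSup_le (bddAbove_range_inner_div (half_pos hc) hl v)
      (bddAbove_range_inner_div hc hhc v) fun w => ?_
    rw [hterm v w w.2 hε0', ← mul_sub_one, abs_mul, mul_assoc]
    refine mul_le_mul (hunit v w w.2) ?_ (abs_nonneg _) (by positivity)
    have h1 := abs_sub (h 0 w / h ε w - 1 + ε * g w) (ε * g w)
    rw [add_sub_cancel_right, abs_mul, abs_of_pos hε0'] at h1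
    have h2 := mul_le_mul_of_nonneg_left (hB w w.2) hε0'.le
    linarith [hε w w.2]
  obtain ⟨m, hm0, hm⟩ := hΩ.exists_gauge_lower_bound hn hc hhc
  have hmB : ∀ᶠ ε in 𝓝[>] (0 : ℝ), ∀ v, m / 2 ≤ M ε v ∧ M ε v ≤ 1 / c + 1 := by
    have hs : ∀ᶠ ε in 𝓝[>] (0 : ℝ), ε < min (m / 2) 1 / C :=
      nhdsWithin_le_nhds (gt_mem_nhds (by positivity))
    filter_upwards [hC, hs] with ε hε hεs v
    rw [lt_div_iff₀ hC0] at hεs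
    have h1 := abs_le.1 (hε v)
    have h2 := hm v
    have h3 : M 0 v ≤ 1 / c := by
      simp only [hM]
      rw [← hTv v]
      exact (abs_le.1 (hunit v _ (hT v))).2
    have h4 := min_le_left (m / 2) 1
    have h5 := min_le_right (m / 2) 1
    change m ≤ M 0 v at h2
    constructor <;> linarith
  have hm2 : ∀ v, m / 2 ≤ M 0 v ∧ M 0 v ≤ 1 / c + 1 := by
    intro v
    have h2 := hm v
    have h3 : M 0 v ≤ 1 / c := by
      simp only [hM]
      rw [← hTv v]
      exact (abs_le.1 (hunit v _ (hT v))).2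
    change m ≤ M 0 v at h2
    constructor <;> linarith
  have hM0pos : ∀ v, 0 < M 0 v := fun v => (half_pos hm0).trans_le (hm2 v).1
  have hrad0 : ∀ v, radialFn (aleksandrovBody Ω (h 0)) v = (M 0 v)⁻¹ := fun v =>
    radialFn_aleksandrovBody hne hc hhc (hM0pos v)
  have hrad : ∀ᶠ ε in 𝓝[>] (0 : ℝ), ∀ v,
      radialFn (aleksandrovBody Ω (h ε)) v = (M ε v)⁻¹ := by
    filter_upwards [hlow, hmB] with ε hl hmε v
    exact radialFn_aleksandrovBody hne (half_pos hc) hl ((half_pos hm0).trans_le (hmε v).1)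
  have hMcont0 : Continuous (M 0) :=
    (lipschitzWith_gauge hne hc hhc).continuous.comp continuous_subtype_val
  have hMcont : ∀ᶠ ε in 𝓝[>] (0 : ℝ), Continuous (M ε) := by
    filter_upwards [hlow] with ε hl
    exact (lipschitzWith_gauge hne (half_pos hc) hl).continuous.comp continuous_subtype_val
  have hGcont : ∀ N : Sph n → ℝ, Continuous N → (∀ v, 0 < N v) →
      Continuous fun v => G (N v)⁻¹ v := fun N hN hN0 =>
    hG.comp_continuous ((hN.inv₀ fun v => (hN0 v).ne').prodMk continuous_id)
      fun v => ⟨inv_pos.2 (hN0 v), mem_univ _⟩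
  have hint : ∀ {F : Sph n → ℝ}, Continuous F → Integrable F (sphMeasure n) := fun hF =>
    hF.integrable_of_hasCompactSupport (HasCompactSupport.of_compactSpace _)
  set I : Set ℝ := Icc (1 / c + 1)⁻¹ (m / 2)⁻¹ with hI
  have hI0 : ∀ t ∈ I, 0 < t := fun t ht => lt_of_lt_of_le (by positivity) ht.1
  have hinvI : ∀ {t : ℝ}, m / 2 ≤ t ∧ t ≤ 1 / c + 1 → t⁻¹ ∈ I := fun ht =>
    ⟨inv_anti₀ ((half_pos hm0).trans_le ht.1) ht.2, inv_anti₀ (half_pos hm0) ht.1⟩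
  obtain ⟨D, hD0, hD⟩ : ∃ D, 0 ≤ D ∧ ∀ t ∈ I, ∀ u, ‖partialT G t u‖ ≤ D := by
    obtain ⟨D, hD⟩ := (isCompact_Icc.prod (isCompact_univ (X := Sph n))).exists_bound_of_continuousOn
      (hGt.mono (prod_mono (fun t ht => hI0 t ht) (subset_univ _)) :
        ContinuousOn (fun p : ℝ × Sph n => partialT G p.1 p.2) (I ×ˢ univ))
    exact ⟨max D 0, le_max_right _ _,
      fun t ht u => (hD (t, u) ⟨ht, mem_univ _⟩).trans (le_max_left _ _)⟩
  have hmain : Tendsto (fun ε => ∫ v, (G (M ε v)⁻¹ v - G (M 0 v)⁻¹ v) / ε ∂(sphMeasure n)) (𝓝[>] 0)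
      (𝓝 (∫ v, g (T v) * ((M 0 v)⁻¹ * partialT G (M 0 v)⁻¹ v) ∂(sphMeasure n))) := by
    refine tendsto_integral_filter_of_dominated_convergence
      (fun _ => D * (C / ((m / 2) * (m / 2)))) ?_ ?_ (integrable_const _) ?_
    · filter_upwards [hMcont, hmB] with ε hcε hmε
      exact (((hGcont _ hcε fun v => (half_pos hm0).trans_le (hmε v).1).sub
        (hGcont _ hMcont0 hM0pos)).div_const ε).aestronglyMeasurable
    · filter_upwards [hC, hmB, self_mem_nhdsWithin] with ε hCε hmε hε0
      have hε0' : 0 < ε := hε0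
      refine ae_of_all _ fun v => ?_
      have hMε := (half_pos hm0).trans_le (hmε v).1
      have h1 : ‖G (M ε v)⁻¹ v - G (M 0 v)⁻¹ v‖ ≤ D * ‖(M ε v)⁻¹ - (M 0 v)⁻¹‖ :=
        Convex.norm_image_sub_le_of_norm_deriv_le (f := fun s => G s v)
          (fun t ht => hGdiff t (hI0 t ht) v) (fun t ht => hD t ht v) (convex_Icc _ _)
          (hinvI (hm2 v)) (hinvI (hmε v))
      have h2 : ‖(M ε v)⁻¹ - (M 0 v)⁻¹‖ ≤ C / ((m / 2) * (m / 2)) * ε := by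
        rw [inv_sub_inv hMε.ne' (hM0pos v).ne', norm_div, Real.norm_eq_abs, abs_sub_comm,
          Real.norm_of_nonneg (mul_pos hMε (hM0pos v)).le, div_mul_eq_mul_div]
        exact div_le_div₀ (by positivity) (hCε v) (by positivity)
          (mul_le_mul (hmε v).1 (hm2 v).1 (by positivity) hMε.le)
      rw [norm_div, Real.norm_of_nonneg hε0'.le, div_le_iff₀ hε0', mul_assoc]
      exact h1.trans (mul_le_mul_of_nonneg_left h2 hD0)
    · filter_upwards [ae_differentiableAt_gauge hne hc hhc] with v hd
      have hder : HasDerivWithinAt (fun ε => M ε v) (M 0 v * -g (T v)) (Ioi 0) 0 := by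
        have := hasDerivWithinAt_iSup_of_unique_max (Ω := Ω) hΩ.1.isCompact
          (A := fun ε w => ⟪(v : EuclideanSpace ℝ (Fin n)), (w : EuclideanSpace ℝ (Fin n))⟫ / h ε w)
          (b := fun w => ⟪(v : EuclideanSpace ℝ (Fin n)), (w : EuclideanSpace ℝ (Fin n))⟫ / h 0 w *
            -g w) (w := T v)
          (ContinuousOn.div (by fun_prop) hh.1 fun w hw => (hh.2 w hw).ne')
          ((ContinuousOn.div (by fun_prop) hh.1 fun w hw => (hh.2 w hw).ne').mul hg.neg)
          (hT v) (fun w hw => (inner_div_le_gauge hc hhc _ hw).trans (hTv v).ge)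
          (fun w hw hwe => eq_of_gauge_eq hd hc hhc (hT v) (hTv v) (hc.trans_le (hhc w hw))
            (fun y => inner_div_le_gauge hc hhc y hw) (hwe.trans (hTv v))) ?_
        · simp only [hTv] at this
          exact this
        · intro δ hδ
          filter_upwards [hexp (δ * c) (by positivity), self_mem_nhdsWithin] with ε hε hε0 w hw
          have hε0' : 0 < ε := hε0
          rw [hterm v w hw hε0']
          set a := ⟪(v : EuclideanSpace ℝ (Fin n)), (w : EuclideanSpace ℝ (Fin n))⟫ / h 0 w with ha
          rw [show a * (h 0 w / h ε w) - a - ε * (a * -g w) =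
            a * (h 0 w / h ε w - 1 + ε * g w) by ring, abs_mul]
          refine (mul_le_mul (hunit v w hw) (hε w hw) (abs_nonneg _) (by positivity)).trans
            (le_of_eq ?_)
          field_simp
      have hinv := hder.inv (hM0pos v).ne'
      have hcomp := (hGdiff (M 0 v)⁻¹ (inv_pos.2 (hM0pos v)) v).hasDerivAt.comp_hasDerivWithinAt
        (0 : ℝ) hinv
      rw [hasDerivWithinAt_iff_tendsto_slope' (by simp)] at hcomp
      convert hcomp using 2
      · simp [slope_def_field]
      · have := (hM0pos v).ne'
        simp only [partialT]
        field_simp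
  simp only [hrad0]
  refine hmain.congr' ?_
  filter_upwards [hrad, hMcont, hmB] with ε hr hcε hmε
  rw [integral_div, integral_sub (hint (hGcont _ hcε fun v => (half_pos hm0).trans_le (hmε v).1))
    (hint (hGcont _ hMcont0 hM0pos))]
  simp only [dualVolume, hr, hrad0]

/-- Uniform first order expansion of the Orlicz combination. -/
theorem orliczCombination_expansion {Ω : Set (Sph n)} (hΩ : IsClosed Ω)
    {h₁ h₂ : Sph n → ℝ} (hh₁ : IsCPos Ω h₁) (hh₂ : IsCPos Ω h₂) {φ₁ φ₂ : ℝ → ℝ}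
    (hφ : (IsClassI φ₁ ∧ IsClassI φ₂) ∨ (IsClassD φ₁ ∧ IsClassD φ₂))
    {d : ℝ} (hd : HasDerivAt φ₁ d 1) (hd0 : d ≠ 0) {h : ℝ → Sph n → ℝ}
    (hh : ∀ ε, 0 < ε → IsOrliczCombination Ω φ₁ φ₂ h₁ h₂ ε (h ε)) {δ : ℝ} (hδ : 0 < δ) :
    ∀ᶠ ε in 𝓝[>] (0 : ℝ), ∀ u ∈ Ω,
      |h₁ u / h ε u - 1 + ε * (φ₂ (h₂ u / h₁ u) / d)| ≤ δ * ε := by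
  have hk : IsCPos Ω fun u => h₂ u / h₁ u :=
    ⟨hh₂.1.div hh₁.1 fun u hu => (hh₁.2 u hu).ne', fun u hu => div_pos (hh₂.2 u hu) (hh₁.2 u hu)⟩
  obtain ⟨p, hp, hpk⟩ := hk.exists_lower_bound hΩ
  obtain ⟨q, hq⟩ := hΩ.isCompact.bddAbove_image hk.1
  filter_upwards [orlicz_expansion hφ hd hd0 hp (q := q) hδ, self_mem_nhdsWithin]
    with ε hε hε0 u hu
  obtain ⟨hf, heq⟩ := hh ε hε0 u hu
  refine hε _ ⟨hpk u hu, hq (mem_image_of_mem _ hu)⟩ _ (div_pos (hh₁.2 u hu) hf) ?_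
  rwa [div_mul_div_cancel₀ (hh₁.2 u hu).ne']

end DualOrlicz
end

open DualOrlicz in
/-- The first conjunct says that `C̃_G([h₁], ·)` is well defined, the second one is the
variational formula. -/
theorem mainTheorem3 (n : ℕ) (hn : 0 < n)
    (Ω : Set (Sph n)) (hΩ : IsAdmissibleDomain Ω)
    (h₁ h₂ : Sph n → ℝ) (hh₁ : IsCPos Ω h₁) (hh₂ : IsCPos Ω h₂)
    (φ₁ φ₂ : ℝ → ℝ)
    (hφ : (IsClassI φ₁ ∧ IsClassI φ₂) ∨ (IsClassD φ₁ ∧ IsClassD φ₂))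
    (hφ₁ : ContDiffOn ℝ 1 φ₁ (Ioi 0)) (hφ₁' : ∀ t, 0 < t → deriv φ₁ t ≠ 0)
    (hφ₂ : ContDiffOn ℝ 1 φ₂ (Ioi 0)) (hφ₂' : ∀ t, 0 < t → deriv φ₂ t ≠ 0)
    (G : ℝ → Sph n → ℝ)
    (hG : ContinuousOn (fun p : ℝ × Sph n => G p.1 p.2) (Ioi 0 ×ˢ univ))
    (hGdiff : ∀ t, 0 < t → ∀ u, DifferentiableAt ℝ (fun s => G s u) t)
    (hGt : ContinuousOn (fun p : ℝ × Sph n => partialT G p.1 p.2) (Ioi 0 ×ˢ univ))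
    (h : ℝ → Sph n → ℝ)
    (hh : ∀ ε, 0 < ε → IsOrliczCombination Ω φ₁ φ₂ h₁ h₂ ε (h ε)) :
    (∀ E : Set (Sph n), MeasurableSet E →
      NullMeasurableSet (reverseRadialGaussImage (aleksandrovBody Ω h₁) E) (sphMeasure n) ∧
      dualCurvatureMeasure G (aleksandrovBody Ω h₁) E =
        (1 / (n : ℝ)) * ∫ u in reverseRadialGaussImage (aleksandrovBody Ω h₁) E,
          radialFn (aleksandrovBody Ω h₁) u *
            partialT G (radialFn (aleksandrovBody Ω h₁) u) u ∂(sphMeasure n)) ∧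
    Tendsto
      (fun ε : ℝ => (dualVolume G (aleksandrovBody Ω (h ε))
        - dualVolume G (aleksandrovBody Ω h₁)) / ε)
      (𝓝[>] 0)
      (𝓝 ((n : ℝ) / deriv φ₁ 1 *
        ∫ᵛ u in Ω, φ₂ (h₂ u / h₁ u) ∂•(dualCurvatureMeasure G (aleksandrovBody Ω h₁)))) := by
  obtain ⟨c, hc, hhc⟩ := hh₁.exists_lower_bound hΩ.1
  have hne := hΩ.nonempty hn
  choose T hT hTv using exists_gauge_eq hΩ.1 hne hh₁ hc hhc
  have hMcont : Continuous fun v : Sph n => aleksandrovGauge Ω h₁ v :=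
    (lipschitzWith_gauge hne hc hhc).continuous.comp continuous_subtype_val
  have hrad : ∀ v, radialFn (aleksandrovBody Ω h₁) v = (aleksandrovGauge Ω h₁ v)⁻¹ := fun v =>
    radialFn_aleksandrovBody hne hc hhc (hΩ.gauge_pos hc hhc v)
  have hradc : Continuous (radialFn (aleksandrovBody Ω h₁)) := by
    rw [funext hrad]
    exact hMcont.inv₀ fun v => (hΩ.gauge_pos hc hhc v).ne'
  have hradpos : ∀ v, 0 < radialFn (aleksandrovBody Ω h₁) v := fun v => by
    rw [hrad]; exact inv_pos.2 (hΩ.gauge_pos hc hhc v)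
  have hGtc : Continuous fun v => partialT G (radialFn (aleksandrovBody Ω h₁) v) v :=
    hGt.comp_continuous (hradc.prodMk continuous_id) fun v => ⟨hradpos v, mem_univ _⟩
  have hα : ∀ E, reverseRadialGaussImage (aleksandrovBody Ω h₁) E =ᵐ[sphMeasure n] T ⁻¹' E := by
    intro E
    filter_upwards [ae_differentiableAt_gauge hne hc hhc] with v hv
    exact propext (mem_reverseRadialGaussImage_iff hn hΩ hc hhc hT hTv hv E)
  obtain ⟨hmeas, hintegral⟩ := dualCurvatureMeasure_spec (G := G) hΩ.1
    (aemeasurable_of_isMax hΩ.1 hne hh₁.1 hc hhc hT hTv) hT hα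
    ((hradc.mul hGtc).integrable_of_hasCompactSupport (HasCompactSupport.of_compactSpace _))
  refine ⟨hmeas, ?_⟩
  have hd : HasDerivAt φ₁ (deriv φ₁ 1) 1 :=
    ((hφ₁.differentiableOn one_ne_zero).differentiableAt (Ioi_mem_nhds one_pos)).hasDerivAt
  have hψ : ContinuousOn (fun u => φ₂ (h₂ u / h₁ u)) Ω := hφ₂.continuousOn.comp
    (hh₂.1.div hh₁.1 fun u hu => (hh₁.2 u hu).ne') fun u hu => div_pos (hh₂.2 u hu) (hh₁.2 u hu)
  have hup : ∀ ε : ℝ, 0 < ε → Function.update h 0 h₁ ε = h ε := fun ε hε =>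
    Function.update_of_ne hε.ne' _ _
  have key := tendsto_dualVolume hn hΩ (h := Function.update h 0 h₁) (by simpa using hh₁)
    (g := fun u => φ₂ (h₂ u / h₁ u) / deriv φ₁ 1) (hψ.div_const _)
    (fun ε hε u hu => by rw [hup ε hε]; exact (hh ε hε u hu).1)
    (fun δ hδ => by
      filter_upwards [orliczCombination_expansion hΩ.1 hh₁ hh₂ hφ hd (hφ₁' 1 one_pos) hh hδ,
        self_mem_nhdsWithin] with ε hε hε0
      rw [hup ε hε0, Function.update_self]
      exact hε)
    hc (by simpa using hhc) hT (by simpa using hTv) hG hGdiff hGt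
  rw [Function.update_self] at key
  convert key.congr' ?_ using 2
  · rw [hintegral _ hψ, ← mul_assoc, ← integral_const_mul]
    refine integral_congr_ae (ae_of_all _ fun v => ?_)
    have hn' : (n : ℝ) ≠ 0 := by exact_mod_cast hn.ne'
    simp only
    field_simp
  · filter_upwards [self_mem_nhdsWithin] with ε hε
    rw [hup ε hε]
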